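/- Work over $\mathbf C$. For $i=1,2$ let $Y^{(i)}$ be an $n$-dimensional toric variety with big torus $T_{Y^{(i)}}$, let $\mathcal V^{(i)}=\mathcal L^{(i)}_1\oplus\dots\oplus\mathcal L^{(i)}_r$ be a sum of line bundles on $Y^{(i)}$ (each $\mathcal L^{(i)}_k$ being the line bundle of a torus-invariant Cartier divisor), let $g^{(i)}=\ell^{(i)}_1+\dots+\ell^{(i)}_r$, $\ell^{(i)}_k\in\Gamma(Y^{(i)},\mathcal L_k^{(i)})$, be a global section, and let $Z^{(i)}\subseteq Y^{(i)}$ be its zero locus. Let $X^{(i)}$ be the total space of the dual bundle of $\mathcal V^{(i)}$, a toric variety. Assume that the tori of $X^{(1)}$ and $X^{(2)}$ are identified with one torus $T$ in such a way that the characters extending to global functions on $X^{(1)}$ and on $X^{(2)}$ are the same (so $X^{(1)}$ and $X^{(2)}$ have the same toric affinization), and that $g^{(1)}$ and $g^{(2)}$, considered as functions on $X^{(1)}$ and $X^{(2)}$, restrict to the same function $W=\sum_\chi c_\chi\chi$ on $T$. There are projections $\pi_i\colon T\to T_{Y^{(i)}}\subseteq Y^{(i)}$. Let $\Lambda^{(i)}_k$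 be the set of characters of $T$ that occur in the expansion of $\ell^{(i)}_k$, considered as a function on $T$, and assume: 1. $\Lambda^{(1)}_k\cap\Lambda^{(2)}_k\neq\varnothing$ for every $k$; 2. for $i=1,2$ the ratios $\chi/\chi'$ with $\chi,\chi'\in\Lambda^{(i)}_k$ for some $k$ generate the group of all characters of $T_{Y^{(i)}}$. Put $W_{ab}=\sum_{\chi\in\Lambda^{(1)}_a\cap\Lambda^{(2)}_b}c_\chi\chi$ and $(W)=(W_{ab})_{a,b}$. Let $D$ be the directed graph on $\{1,\dots,r\}$ with an arrow from $a$ to $b$ when $\Lambda^{(1)}_a\cap\Lambda^{(2)}_b\ne\varnothing$, let $D_{(1)},\dots,D_{(\beta)}$ be its connected components (ignoring directions), and let $$R^{(i)}=\{t\in T \mid \pi_i(t)\in Z^{(i)},\ \operatorname{rank}(W)(t)=r-\beta\},\qquad \Omega^{(i)}=\pi_i\bigl(R^{(1)}\cap R^{(2)}\bigr)\subseteq Z^{(i)} .$$ These are regarded as sets of complex points with their (reduced) variety structure. **Proposition ($O$ torsor).** Let $\lambda=(\lambda_j)_j\in\mathbf G_m^\beta$ act on $T$ by keeping $\pi_1$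 fixed and multiplying by $\lambda_j$ the $k$-th fibre coordinate of $X^{(1)}\to Y^{(1)}$ for every $k\in D_{(j)}$. This coincides with the action defined in the same way by $X^{(2)}\to Y^{(2)}$; it preserves $R^{(1)}\cap R^{(2)}$ and is an algebraic action of $\mathbf G_m^\beta$ on it. For $i=1,2$, the set $\Omega^{(i)}$ is Zariski open in $Z^{(i)}$, and there is an isomorphism of varieties $$R^{(1)}\cap R^{(2)}\;\cong\;\Omega^{(i)}\times\mathbf G_m^\beta$$ whose first component is $\pi_i$ and which is equivariant for $\mathbf G_m^\beta$ acting on the right-hand side trivially on $\Omega^{(i)}$ and by multiplication on $\mathbf G_m^\beta$. -/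

import Mathlib

noncomputable section

/-! Toric varieties, torus-invariant Cartier divisors and split bundles, through fans. -/

/-- The pairing of a real (co)vector with a vector of `N_ℝ = ℝⁿ`. -/
def pairing {n : ℕ} (m u : Fin n → ℝ) : ℝ := ∑ i, m i * u i

/-- An integral vector seen as a real vector. -/
def toReal {n : ℕ} (m : Fin n → ℤ) : Fin n → ℝ := fun i => (m i : ℝ)

/-- `τ` is a face of the cone `σ`: it is cut out of `σ` by a supporting hyperplane. -/
def IsConeFace {n : ℕ} (τ σ : PointedCone ℝ (Fin n → ℝ)) : Prop :=
  ∃ m : Fin n → ℝ, (∀ u ∈ σ, 0 ≤ pairing m u) ∧ ∀ u, u ∈ τ ↔ u ∈ σ ∧ pairing m u = 0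

/-- A fan of strongly convex rational polyhedral cones in `N_ℝ`, where `N = ℤⁿ`, that is, a
toric variety `Y` whose torus `T_Y` has character lattice `M = ℤⁿ`. -/
structure ToricFan (n : ℕ) where
  cones : Set (PointedCone ℝ (Fin n → ℝ))
  finite : cones.Finite
  nonempty : cones.Nonempty
  rational : ∀ σ ∈ cones, ∃ s : Finset (Fin n → ℤ),
    σ = Submodule.span {c : ℝ // 0 ≤ c} (toReal '' (s : Set (Fin n → ℤ)))
  stronglyConvex : ∀ σ ∈ cones, ∀ u ∈ σ, -u ∈ σ → u = 0
  face_mem : ∀ σ ∈ cones, ∀ τ, IsConeFace τ σ → τ ∈ cones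
  inter_face : ∀ σ ∈ cones, ∀ τ ∈ cones, IsConeFace (σ ⊓ τ) σ

/-- A torus-invariant Cartier divisor `D` on the toric variety of a fan, by its local data
`m_σ ∈ M`: on the affine chart of `σ`, the line bundle `𝒪(D)` is generated by `χ^{m_σ}`. -/
structure CartierDatum {n : ℕ} (Y : ToricFan n) where
  slope : Y.cones → (Fin n → ℤ)
  agree : ∀ σ τ : Y.cones, ∀ u ∈ σ.1 ⊓ τ.1,
    pairing (toReal (slope σ)) u = pairing (toReal (slope τ)) u

/-- The characters `m` that are global sections of `𝒪(D)`. -/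
def CartierDatum.sectionCharacters {n : ℕ} {Y : ToricFan n} (D : CartierDatum Y) :
    Set (Fin n → ℤ) :=
  {m | ∀ σ : Y.cones, ∀ u ∈ σ.1, pairing (toReal (D.slope σ)) u ≤ pairing (toReal m) u}

/-- A toric variety `Y`, a split bundle `𝒱 = ℒ_1 ⊕ ⋯ ⊕ ℒ_r` on it with `ℒ_k = 𝒪(D_k)`, and a
global section `g = ℓ_1 + ⋯ + ℓ_r`, given by the character expansions of the `ℓ_k`. -/
structure BundleWithSection (n r : ℕ) where
  Y : ToricFan n
  D : Fin r → CartierDatum Y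
  sec : Fin r → ((Fin n → ℤ) →₀ ℂ)
  sec_global : ∀ k, ∀ m ∈ (sec k).support, m ∈ (D k).sectionCharacters

namespace BundleWithSection

variable {n r : ℕ} (E : BundleWithSection n r)

/-- The characters of the torus of `X`, the total space of `𝒱^∨`, are pairs `(m, d)` with `m` a
character of `T_Y` and `d` the degrees in the fibre coordinates. Those that are global functions
on `X`, i.e. lie in `Γ(Y, Sym 𝒱)`, form this monoid. -/
def globalCharacters : Set ((Fin n → ℤ) × (Fin r → ℤ)) :=
  {p | (∀ k, 0 ≤ p.2 k) ∧ ∀ σ : E.Y.cones, ∀ u ∈ σ.1,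
    ∑ k, (p.2 k : ℝ) * pairing (toReal ((E.D k).slope σ)) u ≤ pairing (toReal p.1) u}

/-- The section `ℓ_k` as a function on `X`. -/
def superpotentialTerm (k : Fin r) : ((Fin n → ℤ) × (Fin r → ℤ)) →₀ ℂ :=
  (E.sec k).mapDomain fun m => (m, Pi.single k 1)

/-- The section `g` as a function on `X`. -/
def superpotential : ((Fin n → ℤ) × (Fin r → ℤ)) →₀ ℂ := ∑ k, E.superpotentialTerm k

end BundleWithSection

/-! Tori and regular maps, at the level of complex points. -/

/-- The complex points of the torus with character lattice `M`. -/
abbrev Torus (M : Type*) [AddCommGroup M] := AddChar M ℂˣ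

/-- The value at a point of the function with the given expansion in characters. -/
def laurentEval {M : Type*} [AddCommGroup M] (p : M →₀ ℂ) (t : Torus M) : ℂ :=
  p.sum fun χ c => c * (t χ : ℂ)

/-- The points of an affine variety over `ℂ` together with its algebra of regular functions. -/
class HasCoordinateRing (P : Type*) where
  coordRing : Subalgebra ℂ (P → ℂ)

instance instCoordTorus {M : Type*} [AddCommGroup M] : HasCoordinateRing (Torus M) where
  coordRing := Algebra.adjoin ℂ {f | ∃ χ : M, f = fun t => (t χ : ℂ)}

/-- The algebraic torus `𝔾_m^ι`. -/
instance instCoordGm {ι : Type*} : HasCoordinateRing (ι → ℂˣ) where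
  coordRing := Algebra.adjoin ℂ
    ({f | ∃ j : ι, f = fun x => (x j : ℂ)} ∪ {f | ∃ j : ι, f = fun x => ((x j)⁻¹ : ℂˣ).val})

/-- The product of two affine varieties. -/
instance instCoordProd {P Q : Type*} [HasCoordinateRing P] [HasCoordinateRing Q] :
    HasCoordinateRing (P × Q) where
  coordRing := Algebra.adjoin ℂ
    ({f | ∃ g ∈ HasCoordinateRing.coordRing (P := P), f = fun x => g x.1} ∪
      {f | ∃ g ∈ HasCoordinateRing.coordRing (P := Q), f = fun x => g x.2})

/-- `X` is a Zariski open subset of `Z`. -/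
def IsZariskiOpenIn {P : Type*} [HasCoordinateRing P] (X Z : Set P) : Prop :=
  X ⊆ Z ∧ ∀ x ∈ X, ∃ f ∈ HasCoordinateRing.coordRing (P := P),
    f x ≠ 0 ∧ ∀ z ∈ Z, f z ≠ 0 → z ∈ X

/-- A map between subvarieties of affine varieties is regular: each coordinate function pulls
back to a function which is locally, in the Zariski topology, a quotient of coordinate functions. -/
def IsRegularMap {P Q : Type*} [HasCoordinateRing P] [HasCoordinateRing Q]
    {X : Set P} {Y : Set Q} (F : X → Y) : Prop :=
  ∀ g ∈ HasCoordinateRing.coordRing (P := Q), ∀ x : X,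
    ∃ p ∈ HasCoordinateRing.coordRing (P := P), ∃ q ∈ HasCoordinateRing.coordRing (P := P),
      q x.1 ≠ 0 ∧ ∀ y : X, q y.1 ≠ 0 → g (F y).1 = p y.1 / q y.1

/-! Two bundles with sections having the same affinization and the same superpotential. -/

/-- Two toric varieties with split bundles and sections (index `0` and `1` of `side`), whose total
spaces have been identified with one affinization `X⁽⁰⁾` along the common torus `T` with character
lattice `L`: `ident i` identifies `L` with the characters of the torus of `X⁽ⁱ⁾`, the global
characters correspond, and the two sections define the same function. -/
structure MirrorPair (n r : ℕ) (L : Type*) [AddCommGroup L] where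
  side : Fin 2 → BundleWithSection n r
  ident : Fin 2 → (L ≃+ (Fin n → ℤ) × (Fin r → ℤ))
  affinization : ∀ χ : L,
    ident 0 χ ∈ (side 0).globalCharacters ↔ ident 1 χ ∈ (side 1).globalCharacters
  same_superpotential :
    (side 0).superpotential.mapDomain (ident 0).symm =
      (side 1).superpotential.mapDomain (ident 1).symm

namespace MirrorPair

variable {n r : ℕ} {L : Type*} [AddCommGroup L] (P : MirrorPair n r L)

/-- The common superpotential `W = ∑ c_χ χ` on `T`. -/
def W : L →₀ ℂ := (P.side 0).superpotential.mapDomain (P.ident 0).symm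

/-- The function `W_k⁽ⁱ⁾` on `T`. -/
def Wterm (i : Fin 2) (k : Fin r) : L →₀ ℂ :=
  ((P.side i).superpotentialTerm k).mapDomain (P.ident i).symm

/-- `Λ_k⁽ⁱ⁾`, the set of characters in the expansion of `W_k⁽ⁱ⁾`. -/
def charSet (i : Fin 2) (k : Fin r) : Finset L := (P.Wterm i k).support

open Classical in
/-- The matrix `(W)` at a point of `T`, with entries
`W_ab = ∑ c_χ χ` over `χ ∈ Λ_a⁽¹⁾ ∩ Λ_b⁽²⁾`. -/
def matrixW (t : Torus L) : Matrix (Fin r) (Fin r) ℂ :=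
  Matrix.of fun a b => ∑ χ ∈ P.charSet 0 a ∩ P.charSet 1 b, P.W χ * (t χ : ℂ)

/-- The arrows of the directed graph `D`. -/
def arrow (a b : Fin r) : Prop := ∃ χ, χ ∈ P.charSet 0 a ∧ χ ∈ P.charSet 1 b

/-- The set of connected components of `D` (forgetting the directions of arrows). -/
def Component : Type := Quotient (Relation.EqvGen.setoid P.arrow)

/-- The component, or block, of an index. -/
def component (k : Fin r) : P.Component := Quotient.mk (Relation.EqvGen.setoid P.arrow) k

/-- The number `β` of blocks. -/
def blockCount : ℕ := Nat.card P.Component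

/-- The torus `𝔾_m^β`, with one coordinate for each component of `D`. -/
abbrev BlockTorus : Type := P.Component → ℂˣ

/-- First assumption: `Λ_k⁽¹⁾ ∩ Λ_k⁽²⁾ ≠ ∅` for all `k`. -/
def DiagonalNonempty : Prop := ∀ k, ∃ χ, χ ∈ P.charSet 0 k ∧ χ ∈ P.charSet 1 k

/-- The characters of `T` that are pulled back from `T_{Y⁽ⁱ⁾}`. -/
def baseCharacters (i : Fin 2) : AddSubgroup L :=
  ((AddMonoidHom.snd (Fin n → ℤ) (Fin r → ℤ)).comp (P.ident i).toAddMonoidHom).ker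

/-- Second assumption: the ratios of characters in the same `Λ_k⁽ⁱ⁾` generate all characters of
`T_{Y⁽ⁱ⁾}`. -/
def RatiosGenerate : Prop := ∀ i, AddSubgroup.closure
  {χ : L | ∃ k, ∃ χ₁ ∈ P.charSet i k, ∃ χ₂ ∈ P.charSet i k, χ = χ₁ - χ₂} = P.baseCharacters i

/-- The projection `T → T_{Y⁽ⁱ⁾}`. -/
def proj (i : Fin 2) (t : Torus L) : Torus (Fin n → ℤ) :=
  t.compAddMonoidHom ((P.ident i).symm.toAddMonoidHom.comp
    (AddMonoidHom.inl (Fin n → ℤ) (Fin r → ℤ)))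

/-- The part of the complete intersection `Z⁽ⁱ⁾` in the open torus `T_{Y⁽ⁱ⁾}` of `Y⁽ⁱ⁾`; all
points of `T` lie over this torus. -/
def Z (i : Fin 2) : Set (Torus (Fin n → ℤ)) :=
  {y | ∀ k, laurentEval ((P.side i).sec k) y = 0}

/-- The subset `S⁽ⁱ⁾` of `T` lying over `Z⁽ⁱ⁾`. -/
def S (i : Fin 2) : Set (Torus L) := {t | P.proj i t ∈ P.Z i}

/-- The subset `R⁽ⁱ⁾` of `S⁽ⁱ⁾` on which `(W)` has rank `r - β`. -/
def R (i : Fin 2) : Set (Torus L) := {t | t ∈ P.S i ∧ (P.matrixW t).rank + P.blockCount = r}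

/-- `R⁽¹⁾ ∩ R⁽²⁾`. -/
def RR : Set (Torus L) := P.R 0 ∩ P.R 1

/-- `Ω⁽ⁱ⁾`, the image of `R⁽¹⁾ ∩ R⁽²⁾` in `Z⁽ⁱ⁾`. -/
def Omega (i : Fin 2) : Set (Torus (Fin n → ℤ)) := P.proj i '' P.RR

/-- The one-parameter-per-block subgroup of `T` through which `𝔾_m^β` rescales the fibre
coordinates of `X⁽ⁱ⁾ → Y⁽ⁱ⁾`: the coordinates of `Y⁽ⁱ⁾` are kept and the `k`-th fibre coordinate
is multiplied by `lam (component k)`. -/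
def blockScaling (i : Fin 2) : P.BlockTorus →* Torus L where
  toFun lam :=
    { toFun := fun χ => ∏ k, lam (P.component k) ^ ((P.ident i χ).2 k)
      map_zero_eq_one' := by simp
      map_add_eq_mul' := by
        intro χ₁ χ₂
        simp [zpow_add, Finset.prod_mul_distrib] }
  map_one' := by
    ext χ
    simp
  map_mul' lam₁ lam₂ := by
    ext χ
    simp [mul_zpow, Finset.prod_mul_distrib]

end MirrorPair

end

/-!
Vanishing of the section `g⁽ⁱ⁾` at `π_i(t)` means that the row sums (for `i = 0`) or the column sums
(for `i = 1`) of `(W)(t)` vanish. Write `T` as `T_{Y⁽ⁱ⁾} × 𝔾_m^r`, with fibre coordinates `x`; up to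
transposition, `(W)` is then `diag(x) A(y)` for a matrix `A` of functions on `T_{Y⁽ⁱ⁾}`. So `(y, x)`
lies over both zero loci if and only if `A(y) 1 = 0` and `x A(y) = 0`. Since `A(y)` is block
diagonal with blocks the components `D_(j)`, each block has a kernel, and rank `r - β` means that
these kernels are one-dimensional; as `x` has no zero entry, it is then determined by `y` up to one
scalar for each block, whence the torsor. It is trivial because `x` can be normalized to `1` at one
index in each block: adding `1` to `A(y)` at these diagonal entries makes it invertible, and the
inverse gives the normalized `x` as a rational function of `y`.
-/

section BlockDiagonal

open Matrix
open Set (range indicator_congr indicator_zero')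

variable {ι C R : Type*} [Fintype ι]

/-- The square matrix `A` is block diagonal for the partition of its index set into the fibres of
`c`. No order on the blocks is needed. -/
def IsBlockDiagonal [Zero R] (c : ι → C) (A : Matrix ι ι R) : Prop :=
  ∀ a b, c a ≠ c b → A a b = 0

/-- The matrix `A` with `1` added to the diagonal entries at the indices `s j`. For a block
diagonal matrix `A` with vanishing row sums and one index `s j` in each block, this breaks the
obvious degeneracy of `A` on vectors that are constant on the blocks. -/
noncomputable def pinnedMatrix [DecidableEq ι] [CommRing R] (A : Matrix ι ι R)
    (s : C → ι) : Matrix ι ι R :=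
  A + diagonal ((range s).indicator 1)

/-- The vector in the left kernel of `A` with value `1` at each of the indices `s j`, if
`pinnedMatrix A s` is invertible. -/
noncomputable def normalizedKernelVector [DecidableEq ι] [CommRing R] (A : Matrix ι ι R)
    (s : C → ι) : ι → R :=
  (range s).indicator 1 ᵥ* (pinnedMatrix A s)⁻¹

theorem indicator_range_dotProduct_comp [CommRing R] [DecidableEq C] {c : ι → C} {s : C → ι}
    (hs : Function.LeftInverse c s) (x : ι → R) (j : C) :
    (range s).indicator x ⬝ᵥ (Pi.single j 1 ∘ c) = x (s j) := by
  rw [dotProduct, Finset.sum_eq_single (s j) _ (by simp)]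
  · simp [hs j]
  · rintro k - hk
    by_cases hks : k ∈ range s
    · obtain ⟨j', rfl⟩ := hks
      have hj : j' ≠ j := fun h => hk (congrArg s h)
      simp [hs j', hj]
    · simp [hks]

namespace IsBlockDiagonal

variable {A : Matrix ι ι R} {c : ι → C}

theorem commute_diagonal [DecidableEq ι] [CommSemiring R] (hA : IsBlockDiagonal c A) (lam : C → R) :
    Commute A (diagonal (lam ∘ c)) := by
  ext a b
  rw [mul_diagonal, diagonal_mul, mul_comm]
  by_cases hab : c a = c b
  · rw [Function.comp_apply, Function.comp_apply, hab]
  · rw [hA a b hab, mul_zero, mul_zero]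

theorem mulVec_comp_eq_zero [CommSemiring R] (hA : IsBlockDiagonal c A) (hrow : A *ᵥ 1 = 0)
    (lam : C → R) : A *ᵥ (lam ∘ c) = 0 := by
  classical
  have hlam : diagonal (lam ∘ c) *ᵥ 1 = lam ∘ c := by
    ext k
    rw [mulVec_diagonal, Pi.one_apply, mul_one]
  rw [← hlam, mulVec_mulVec, (hA.commute_diagonal lam).eq, ← mulVec_mulVec, hrow, mulVec_zero]

theorem comp_mul_vecMul_eq_zero [CommSemiring R] (hA : IsBlockDiagonal c A) {x : ι → R}
    (hx : x ᵥ* A = 0) (lam : C → R) : ((lam ∘ c) * x) ᵥ* A = 0 := by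
  classical
  have hlam : x ᵥ* diagonal (lam ∘ c) = (lam ∘ c) * x := by
    ext k
    rw [vecMul_diagonal, Pi.mul_apply, mul_comm]
  rw [← hlam, vecMul_vecMul, ← (hA.commute_diagonal lam).eq, ← vecMul_vecMul, hx, zero_vecMul]

end IsBlockDiagonal

variable [DecidableEq ι] {c : ι → C} {s : C → ι}

theorem vecMul_pinnedMatrix [CommRing R] (A : Matrix ι ι R) (s : C → ι) (x : ι → R) :
    x ᵥ* pinnedMatrix A s = x ᵥ* A + (range s).indicator x := by
  rw [pinnedMatrix, vecMul_add]
  congr 1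
  ext k
  by_cases hk : k ∈ range s <;> simp [vecMul_diagonal, hk]

namespace IsBlockDiagonal

section CommRing

variable [CommRing R] {A : Matrix ι ι R}

theorem vecMul_pinnedMatrix_eq_iff (hA : IsBlockDiagonal c A) (hrow : A *ᵥ 1 = 0)
    (hs : Function.LeftInverse c s) {x : ι → R} {lam : C → R} :
    x ᵥ* pinnedMatrix A s = (range s).indicator (lam ∘ c) ↔ x ᵥ* A = 0 ∧ x ∘ s = lam := by
  classical
  have hind (h : x ∘ s = lam) : (range s).indicator x = (range s).indicator (lam ∘ c) := by
    refine indicator_congr ?_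
    rintro _ ⟨j, rfl⟩
    rw [Function.comp_apply, hs j, ← h, Function.comp_apply]
  refine ⟨fun h => ?_, fun ⟨hx, h⟩ => by rw [vecMul_pinnedMatrix, hx, zero_add, hind h]⟩
  have hxs : x ∘ s = lam := by
    funext j
    calc x (s j) = (x ᵥ* A + (range s).indicator x) ⬝ᵥ (Pi.single j 1 ∘ c) := by
          rw [add_dotProduct, ← dotProduct_mulVec, hA.mulVec_comp_eq_zero hrow, dotProduct_zero,
            zero_add, indicator_range_dotProduct_comp hs]
      _ = (range s).indicator (lam ∘ c) ⬝ᵥ (Pi.single j 1 ∘ c) := by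
          rw [← vecMul_pinnedMatrix, h]
      _ = lam j := by rw [indicator_range_dotProduct_comp hs, Function.comp_apply, hs j]
  rw [vecMul_pinnedMatrix, hind hxs, add_eq_right] at h
  exact ⟨h, hxs⟩

theorem normalizedKernelVector_spec (hA : IsBlockDiagonal c A) (hrow : A *ᵥ 1 = 0)
    (hs : Function.LeftInverse c s) (hdet : IsUnit (pinnedMatrix A s).det) :
    normalizedKernelVector A s ᵥ* A = 0 ∧ normalizedKernelVector A s ∘ s = 1 := by
  refine (hA.vecMul_pinnedMatrix_eq_iff hrow hs).1 ?_
  rw [normalizedKernelVector, vecMul_vecMul, nonsing_inv_mul _ hdet, vecMul_one]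
  rfl

theorem vecMul_eq_zero_iff_eq_mul_normalizedKernelVector (hA : IsBlockDiagonal c A)
    (hrow : A *ᵥ 1 = 0) (hs : Function.LeftInverse c s) (hdet : IsUnit (pinnedMatrix A s).det)
    {x : ι → R} : x ᵥ* A = 0 ↔ x = (x ∘ s ∘ c) * normalizedKernelVector A s := by
  obtain ⟨hv, hvs⟩ := hA.normalizedKernelVector_spec hrow hs hdet
  have hmul : ((x ∘ s ∘ c) * normalizedKernelVector A s) ᵥ* A = 0 :=
    hA.comp_mul_vecMul_eq_zero hv (x ∘ s)
  refine ⟨fun hx => ?_, fun hx => hx ▸ hmul⟩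
  refine vecMul_injective_of_isUnit ((isUnit_iff_isUnit_det _).2 hdet) ?_
  change x ᵥ* pinnedMatrix A s = ((x ∘ s ∘ c) * normalizedKernelVector A s) ᵥ* pinnedMatrix A s
  rw [(hA.vecMul_pinnedMatrix_eq_iff hrow hs).2 ⟨hx, rfl⟩,
    (hA.vecMul_pinnedMatrix_eq_iff hrow hs (lam := x ∘ s)).2 ⟨hmul, ?_⟩]
  funext j
  have hvj : normalizedKernelVector A s (s j) = 1 := congrFun hvs j
  simp only [Function.comp_apply, Pi.mul_apply, hs j, hvj, mul_one]

end CommRing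

section Field

variable {K : Type*} [Field K] {A : Matrix ι ι K}

theorem det_pinnedMatrix_ne_zero_iff (hA : IsBlockDiagonal c A) (hrow : A *ᵥ 1 = 0)
    (hs : Function.LeftInverse c s) :
    (pinnedMatrix A s).det ≠ 0 ↔ ∀ x : ι → K, x ᵥ* A = 0 → x ∘ s = 0 → x = 0 := by
  have hker (x : ι → K) : x ᵥ* pinnedMatrix A s = 0 ↔ x ᵥ* A = 0 ∧ x ∘ s = 0 := by
    rw [← hA.vecMul_pinnedMatrix_eq_iff hrow hs, Pi.zero_comp, indicator_zero']
  rw [ne_eq, ← exists_vecMul_eq_zero_iff]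
  simp only [hker]
  grind

theorem rank_add_card_eq_iff (hA : IsBlockDiagonal c A) (hrow : A *ᵥ 1 = 0)
    (hs : Function.LeftInverse c s) {x : ι → K} (hx : x ᵥ* A = 0) (hxs : ∀ j, x (s j) ≠ 0) :
    A.rank + Nat.card C = Fintype.card ι ↔ (pinnedMatrix A s).det ≠ 0 := by
  have := Finite.of_injective s hs.injective
  have := Fintype.ofFinite C
  let restrict : LinearMap.ker A.vecMulLinear →ₗ[K] C → K :=
    (LinearMap.funLeft K K s).comp (Submodule.subtype _)
  have hsurj : Function.Surjective restrict := fun lam => by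
    refine ⟨⟨((lam / (x ∘ s)) ∘ c) * x, hA.comp_mul_vecMul_eq_zero hx _⟩, funext fun j => ?_⟩
    simp [restrict, LinearMap.funLeft, hs j, hxs j]
  have hinj : Function.Injective restrict ↔ (pinnedMatrix A s).det ≠ 0 := by
    rw [hA.det_pinnedMatrix_ne_zero_iff hrow hs, ← LinearMap.ker_eq_bot,
      LinearMap.ker_eq_bot']
    exact ⟨fun h z hz hzs => congrArg Subtype.val (h ⟨z, hz⟩ hzs),
      fun h z hz => Subtype.ext (h z.1 z.2 hz)⟩
  have hdim : A.rank + Module.finrank K (LinearMap.ker A.vecMulLinear) = Fintype.card ι := by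
    rw [← rank_transpose A, Matrix.rank, mulVecLin_transpose,
      LinearMap.finrank_range_add_finrank_ker, Module.finrank_fintype_fun_eq_card]
  rw [← hinj, ← hdim, Nat.card_eq_fintype_card, Nat.add_left_cancel_iff,
    ← Module.finrank_fintype_fun_eq_card K]
  refine ⟨fun h => ?_, fun h => ?_⟩
  · exact (LinearMap.injective_iff_surjective_of_finrank_eq_finrank h.symm).2 hsurj
  · exact (LinearEquiv.ofBijective restrict ⟨h, hsurj⟩).finrank_eq.symm

theorem vecMul_eq_zero_and_rank_add_card_eq_iff (hA : IsBlockDiagonal c A) (hrow : A *ᵥ 1 = 0)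
    (hs : Function.LeftInverse c s) {x : ι → K} (hxs : ∀ j, x (s j) ≠ 0) :
    x ᵥ* A = 0 ∧ A.rank + Nat.card C = Fintype.card ι ↔
      (pinnedMatrix A s).det ≠ 0 ∧ x = (x ∘ s ∘ c) * normalizedKernelVector A s := by
  rw [← and_congr_right fun hx => (hA.rank_add_card_eq_iff hrow hs hx hxs).symm, and_comm]
  exact and_congr_right fun hdet =>
    hA.vecMul_eq_zero_iff_eq_mul_normalizedKernelVector hrow hs hdet.isUnit

end Field

end IsBlockDiagonal

end BlockDiagonal

section FunctionAlgebra

open Matrix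

variable {X R ι : Type*} [CommRing R] {S : Subalgebra R (X → R)}

theorem fun_sum_mem {s : Finset ι} {f : ι → X → R} (h : ∀ a ∈ s, f a ∈ S) :
    (fun x => ∑ a ∈ s, f a x) ∈ S := by
  simpa only [Finset.sum_fn] using sum_mem h

theorem fun_prod_mem {s : Finset ι} {f : ι → X → R} (h : ∀ a ∈ s, f a ∈ S) :
    (fun x => ∏ a ∈ s, f a x) ∈ S := by
  simpa only [Finset.prod_fn] using prod_mem h

variable [Fintype ι] [DecidableEq ι] {M : X → Matrix ι ι R}

theorem fun_det_mem (h : ∀ a b, (fun x => M x a b) ∈ S) : (fun x => (M x).det) ∈ S := by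
  simp only [det_apply']
  exact fun_sum_mem fun σ _ => S.mul_mem (S.algebraMap_mem _) (fun_prod_mem fun a _ => h _ _)

theorem fun_adjugate_mem (h : ∀ a b, (fun x => M x a b) ∈ S) (a b : ι) :
    (fun x => (M x).adjugate a b) ∈ S := by
  simp only [adjugate_apply]
  refine fun_det_mem fun i j => ?_
  by_cases hi : i = b
  · simp only [hi, updateRow_self]
    exact S.algebraMap_mem _
  · simpa only [updateRow_ne hi] using h i j

end FunctionAlgebra

section RegularFunctions

open HasCoordinateRing (coordRing)

section Subset

variable {P : Type*} [HasCoordinateRing P] {X : Set P} {f : X → ℂ}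

/-- The algebra of regular functions on a subset of an affine variety: those functions which are
locally, in the Zariski topology, quotients of coordinate functions. -/
def regularFunctions (X : Set P) : Subalgebra ℂ (X → ℂ) where
  carrier := {f | ∀ x : X, ∃ p ∈ coordRing (P := P), ∃ q ∈ coordRing (P := P),
    q x.1 ≠ 0 ∧ ∀ y : X, q y.1 ≠ 0 → f y = p y.1 / q y.1}
  mul_mem' := by
    intro f g hf hg x
    obtain ⟨p, hp, q, hq, hqx, hfpq⟩ := hf x
    obtain ⟨p', hp', q', hq', hqx', hgpq⟩ := hg x
    refine ⟨p * p', mul_mem hp hp', q * q', mul_mem hq hq', mul_ne_zero hqx hqx', fun y hy => ?_⟩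
    obtain ⟨hqy, hqy'⟩ := mul_ne_zero_iff.1 hy
    simp only [Pi.mul_apply, hfpq y hqy, hgpq y hqy', div_mul_div_comm]
  add_mem' := by
    intro f g hf hg x
    obtain ⟨p, hp, q, hq, hqx, hfpq⟩ := hf x
    obtain ⟨p', hp', q', hq', hqx', hgpq⟩ := hg x
    refine ⟨p * q' + q * p', add_mem (mul_mem hp hq') (mul_mem hq hp'), q * q', mul_mem hq hq',
      mul_ne_zero hqx hqx', fun y hy => ?_⟩
    obtain ⟨hqy, hqy'⟩ := mul_ne_zero_iff.1 hy
    simp only [Pi.add_apply, Pi.mul_apply, hfpq y hqy, hgpq y hqy', div_add_div _ _ hqy hqy']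
  algebraMap_mem' z := fun _ => ⟨algebraMap ℂ _ z, Subalgebra.algebraMap_mem _ z, 1, one_mem _,
    one_ne_zero, fun _ _ => (div_one _).symm⟩

theorem isRegularMap_iff {Q : Type*} [HasCoordinateRing Q] {Y : Set Q} {F : X → Y} :
    IsRegularMap F ↔
      ∀ g ∈ coordRing (P := Q), (fun x => g (F x)) ∈ regularFunctions X := Iff.rfl

theorem restrict_mem_regularFunctions {f : P → ℂ} (hf : f ∈ coordRing (P := P)) :
    (fun x : X => f x) ∈ regularFunctions X :=
  fun _ => ⟨f, hf, 1, one_mem _, one_ne_zero, fun _ _ => (div_one _).symm⟩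

theorem inv_mem_regularFunctions (hf : f ∈ regularFunctions X) (hf₀ : ∀ x, f x ≠ 0) :
    (fun x => (f x)⁻¹) ∈ regularFunctions X := by
  intro x
  obtain ⟨p, hp, q, hq, hqx, hfpq⟩ := hf x
  have hpx : p x.1 ≠ 0 := fun hpx => hf₀ x (by rw [hfpq x hqx, hpx, zero_div])
  refine ⟨q * q, mul_mem hq hq, p * q, mul_mem hp hq, mul_ne_zero hpx hqx, fun y hy => ?_⟩
  obtain ⟨-, hqy⟩ := mul_ne_zero_iff.1 hy
  change (f y)⁻¹ = _
  rw [hfpq y hqy, inv_div, Pi.mul_apply, Pi.mul_apply, mul_div_mul_right _ _ hqy]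

theorem zpow_mem_regularFunctions (hf : f ∈ regularFunctions X) (hf₀ : ∀ x, f x ≠ 0) (m : ℤ) :
    (fun x => f x ^ m) ∈ regularFunctions X := by
  cases m with
  | ofNat a =>
    simp only [Int.ofNat_eq_natCast, zpow_natCast]
    exact pow_mem hf a
  | negSucc a =>
    simp only [zpow_negSucc]
    exact inv_mem_regularFunctions (pow_mem hf (a + 1)) fun x => pow_ne_zero _ (hf₀ x)

theorem normalizedKernelVector_mem_regularFunctions {ι C : Type*} [Fintype ι] [DecidableEq ι]
    {M : X → Matrix ι ι ℂ} {s : C → ι} (hM : ∀ a b, (fun x => M x a b) ∈ regularFunctions X)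
    (hdet : ∀ x, (pinnedMatrix (M x) s).det ≠ 0) (k : ι) :
    (fun x => normalizedKernelVector (M x) s k) ∈ regularFunctions X := by
  have hpinned (a b : ι) : (fun x => pinnedMatrix (M x) s a b) ∈ regularFunctions X :=
    add_mem (hM a b) (Subalgebra.algebraMap_mem _ _)
  have hinv (a b : ι) : (fun x => (pinnedMatrix (M x) s)⁻¹ a b) ∈ regularFunctions X := by
    simp only [Matrix.inv_def, Ring.inverse_eq_inv', Matrix.smul_apply, smul_eq_mul]
    exact mul_mem (inv_mem_regularFunctions (fun_det_mem hpinned) hdet)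
      (fun_adjugate_mem hpinned a b)
  exact fun_sum_mem (s := Finset.univ) fun a _ =>
    mul_mem (Subalgebra.algebraMap_mem (regularFunctions X) _) (hinv a k)

theorem isZariskiOpenIn_refl (X : Set P) : IsZariskiOpenIn X X :=
  ⟨subset_rfl, fun _ _ => ⟨1, one_mem _, one_ne_zero, fun _ hz _ => hz⟩⟩

theorem IsZariskiOpenIn.sep_ne_zero {Z : Set P} (hX : IsZariskiOpenIn X Z) {f : P → ℂ}
    (hf : (fun x : X => f x) ∈ regularFunctions X) : IsZariskiOpenIn {x ∈ X | f x ≠ 0} Z := by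
  refine ⟨fun x hx => hX.1 hx.1, fun x ⟨hx, hfx⟩ => ?_⟩
  obtain ⟨g, hg, hgx, hgX⟩ := hX.2 x hx
  obtain ⟨p, hp, q, hq, hqx, hfpq⟩ := hf ⟨x, hx⟩
  have hpx : p x ≠ 0 := fun hpx => hfx ((hfpq ⟨x, hx⟩ hqx).trans (by rw [hpx, zero_div]))
  refine ⟨g * (p * q), mul_mem hg (mul_mem hp hq), mul_ne_zero hgx (mul_ne_zero hpx hqx),
    fun z hz hgpq => ?_⟩
  obtain ⟨hgz, hpz, hqz⟩ := (mul_ne_zero_iff.1 hgpq).imp_right mul_ne_zero_iff.1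
  have hzX := hgX z hz hgz
  exact ⟨hzX, (hfpq ⟨z, hzX⟩ hqz).trans_ne (div_ne_zero hpz hqz)⟩

end Subset

section Pullback

theorem comp_mem_of_mem_adjoin {A B R : Type*} [CommSemiring R] {s : Set (B → R)}
    {S : Subalgebra R (A → R)} {φ : A → B} (hs : ∀ g ∈ s, g ∘ φ ∈ S) {g : B → R}
    (hg : g ∈ Algebra.adjoin R s) : g ∘ φ ∈ S := by
  induction hg using Algebra.adjoin_induction with
  | mem g hg => exact hs g hg
  | algebraMap z => exact S.algebraMap_mem z
  | add _ _ _ _ hf hg => exact add_mem hf hg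
  | mul _ _ _ _ hf hg => exact mul_mem hf hg

variable {A P Q M ι : Type*} [HasCoordinateRing P] [HasCoordinateRing Q] [AddCommGroup M]

theorem comp_mem_of_character_mem {S : Subalgebra ℂ (A → ℂ)} {φ : A → Torus M}
    (h : ∀ χ, (fun a => (φ a χ : ℂ)) ∈ S) {g : Torus M → ℂ} (hg : g ∈ coordRing (P := Torus M)) :
    g ∘ φ ∈ S := by
  refine comp_mem_of_mem_adjoin ?_ hg
  rintro _ ⟨χ, rfl⟩
  exact h χ

theorem comp_mem_regularFunctions_of_coordinate_mem {X : Set P} {φ : X → ι → ℂˣ}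
    (h : ∀ j, (fun x => (φ x j : ℂ)) ∈ regularFunctions X) {g : (ι → ℂˣ) → ℂ}
    (hg : g ∈ coordRing (P := ι → ℂˣ)) : g ∘ φ ∈ regularFunctions X := by
  refine comp_mem_of_mem_adjoin ?_ hg
  rintro _ (⟨j, rfl⟩ | ⟨j, rfl⟩)
  · exact h j
  · simpa only [Function.comp_def, Units.val_inv_eq_inv_val] using
      inv_mem_regularFunctions (h j) fun x => (φ x j).ne_zero

theorem comp_mem_of_fst_mem_of_snd_mem {S : Subalgebra ℂ (A → ℂ)} {φ : A → P × Q}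
    (hfst : ∀ g ∈ coordRing (P := P), (fun a => g (φ a).1) ∈ S)
    (hsnd : ∀ g ∈ coordRing (P := Q), (fun a => g (φ a).2) ∈ S) {g : P × Q → ℂ}
    (hg : g ∈ coordRing (P := P × Q)) : g ∘ φ ∈ S := by
  refine comp_mem_of_mem_adjoin ?_ hg
  rintro _ (⟨g, hg, rfl⟩ | ⟨g, hg, rfl⟩)
  · exact hfst g hg
  · exact hsnd g hg

theorem character_mem_coordRing (χ : M) :
    (fun t : Torus M => (t χ : ℂ)) ∈ coordRing (P := Torus M) :=
  Algebra.subset_adjoin ⟨χ, rfl⟩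

theorem coordinate_mem_coordRing (j : ι) :
    (fun x : ι → ℂˣ => (x j : ℂ)) ∈ coordRing (P := ι → ℂˣ) :=
  Algebra.subset_adjoin (Or.inl ⟨j, rfl⟩)

theorem comp_fst_mem_coordRing {g : P → ℂ} (hg : g ∈ coordRing (P := P)) :
    (fun x : P × Q => g x.1) ∈ coordRing (P := P × Q) :=
  Algebra.subset_adjoin (Or.inl ⟨g, hg, rfl⟩)

theorem comp_snd_mem_coordRing {g : Q → ℂ} (hg : g ∈ coordRing (P := Q)) :
    (fun x : P × Q => g x.2) ∈ coordRing (P := P × Q) :=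
  Algebra.subset_adjoin (Or.inr ⟨g, hg, rfl⟩)

end Pullback

end RegularFunctions

theorem torus_apply_eq_prod_zpow {ι : Type*} [Fintype ι] [DecidableEq ι] (t : Torus (ι → ℤ))
    (d : ι → ℤ) : t d = ∏ k, t (Pi.single k 1) ^ d k := by
  have hsum := map_sum t.toAddMonoidHom (fun k => d k • Pi.single k (1 : ℤ)) Finset.univ
  simp only [map_zsmul, ← pi_eq_sum_univ' d] at hsum
  exact hsum

namespace MirrorPair

open Matrix
open HasCoordinateRing (coordRing)

variable {n r : ℕ} {L : Type*} [AddCommGroup L] (P : MirrorPair n r L)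

section Superpotential

variable {P} {i : Fin 2} {k l : Fin r} {χ : L}

theorem W_eq_sum_Wterm (P : MirrorPair n r L) (i : Fin 2) : P.W = ∑ k, P.Wterm i k := by
  have hW : P.W = (P.side i).superpotential.mapDomain (P.ident i).symm := by
    fin_cases i
    · rfl
    · exact P.same_superpotential
  rw [hW, BundleWithSection.superpotential]
  exact map_sum (Finsupp.mapDomain.addMonoidHom (P.ident i).symm) _ _

theorem ident_snd_of_mem_charSet (h : χ ∈ P.charSet i k) : (P.ident i χ).2 = Pi.single k 1 := by
  classical
  obtain ⟨p, hp, rfl⟩ := Finset.mem_image.1 (Finsupp.mapDomain_support h)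
  obtain ⟨m, -, rfl⟩ := Finset.mem_image.1 (Finsupp.mapDomain_support hp)
  rw [AddEquiv.apply_symm_apply]

theorem eq_of_mem_charSet (hk : χ ∈ P.charSet i k) (hl : χ ∈ P.charSet i l) : k = l := by
  have hkl := (ident_snd_of_mem_charSet hk).symm.trans (ident_snd_of_mem_charSet hl)
  by_contra hne
  simpa [hne] using congrFun hkl k

theorem W_apply_of_mem_charSet (h : χ ∈ P.charSet i k) : P.W χ = P.Wterm i k χ := by
  rw [P.W_eq_sum_Wterm i, Finsupp.finsetSum_apply, Finset.sum_eq_single k _ (by simp)]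
  intro l _ hl
  by_contra hχ
  exact hl (eq_of_mem_charSet (Finsupp.mem_support_iff.2 hχ) h)

theorem mem_support_W_iff (i : Fin 2) : χ ∈ P.W.support ↔ ∃ k, χ ∈ P.charSet i k := by
  refine ⟨fun h => ?_, fun ⟨k, hk⟩ => ?_⟩
  · rw [Finsupp.mem_support_iff, P.W_eq_sum_Wterm i, Finsupp.finsetSum_apply] at h
    obtain ⟨k, -, hk⟩ := Finset.exists_ne_zero_of_sum_ne_zero h
    exact ⟨k, Finsupp.mem_support_iff.2 hk⟩
  · rw [Finsupp.mem_support_iff, W_apply_of_mem_charSet hk]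
    exact Finsupp.mem_support_iff.1 hk

theorem component_eq_of_mem_charSet (hk : χ ∈ P.charSet i k) (hl : χ ∈ P.charSet i.rev l) :
    P.component k = P.component l := by
  refine Quotient.sound ?_
  fin_cases i
  · exact .rel _ _ ⟨χ, hk, hl⟩
  · exact .symm _ _ (.rel _ _ ⟨χ, hl, hk⟩)

open Classical in
theorem sum_sum_charSet_inter {M : Type*} [AddCommMonoid M] (P : MirrorPair n r L) (i : Fin 2)
    (k : Fin r) (f : L → M) :
    ∑ l, ∑ χ ∈ P.charSet i k ∩ P.charSet i.rev l, f χ = ∑ χ ∈ P.charSet i k, f χ := by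
  have hdisj : (Set.univ : Set (Fin r)).PairwiseDisjoint
      fun l => P.charSet i k ∩ P.charSet i.rev l := fun l _ l' _ hll' =>
    Finset.disjoint_left.2 fun χ hl hl' =>
      hll' (eq_of_mem_charSet (Finset.mem_inter.1 hl).2 (Finset.mem_inter.1 hl').2)
  rw [← Finset.sum_biUnion (by simpa using hdisj), ← Finset.inter_biUnion,
    Finset.inter_eq_left.2 fun χ hχ => ?_]
  simpa using (mem_support_W_iff i.rev).1 ((mem_support_W_iff i).2 ⟨k, hχ⟩)

end Superpotential

section BlockScaling

theorem blockScaling_apply_of_mem_charSet {i : Fin 2} {k : Fin r} {χ : L}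
    (h : χ ∈ P.charSet i k) (lam : P.BlockTorus) :
    P.blockScaling i lam χ = lam (P.component k) := by
  change ∏ l, lam (P.component l) ^ (P.ident i χ).2 l = _
  rw [ident_snd_of_mem_charSet h, Finset.prod_eq_single k _ (by simp), Pi.single_eq_same, zpow_one]
  intro l _ hl
  rw [Pi.single_eq_of_ne hl, zpow_zero]

theorem blockScaling_eq (hW : AddSubgroup.closure (P.W.support : Set L) = ⊤) :
    P.blockScaling 0 = P.blockScaling 1 := by
  ext lam : 1
  refine AddChar.toAddMonoidHomEquiv.injective (AddMonoidHom.eq_of_eqOn_dense hW fun χ hχ => ?_)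
  obtain ⟨k, hk⟩ := (mem_support_W_iff 0).1 hχ
  obtain ⟨l, hl⟩ := (mem_support_W_iff 1).1 hχ
  change P.blockScaling 0 lam χ = P.blockScaling 1 lam χ
  rw [P.blockScaling_apply_of_mem_charSet hk, P.blockScaling_apply_of_mem_charSet hl,
    component_eq_of_mem_charSet (i := 0) hk hl]

theorem closure_support_W_eq_top {i : Fin 2} (hne : ∀ k, (P.charSet i k).Nonempty)
    (hbase : P.baseCharacters i ≤ AddSubgroup.closure
      {χ : L | ∃ k, ∃ χ₁ ∈ P.charSet i k, ∃ χ₂ ∈ P.charSet i k, χ = χ₁ - χ₂}) :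
    AddSubgroup.closure (P.W.support : Set L) = ⊤ := by
  set H := AddSubgroup.closure (P.W.support : Set L)
  have hmem {k : Fin r} {χ : L} (hχ : χ ∈ P.charSet i k) : χ ∈ H :=
    AddSubgroup.subset_closure ((mem_support_W_iff i).2 ⟨k, hχ⟩)
  have hbaseH : P.baseCharacters i ≤ H := by
    refine hbase.trans ((AddSubgroup.closure_le H).2 ?_)
    rintro _ ⟨k, χ₁, hχ₁, χ₂, hχ₂, rfl⟩
    exact H.sub_mem (hmem hχ₁) (hmem hχ₂)
  choose e he using hne
  refine (AddSubgroup.eq_top_iff' H).2 fun χ => ?_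
  have hdiff : χ - ∑ k, (P.ident i χ).2 k • e k ∈ P.baseCharacters i := by
    change (P.ident i (χ - ∑ k, (P.ident i χ).2 k • e k)).2 = 0
    simp only [map_sub, map_sum, map_zsmul, Prod.snd_sub, Prod.snd_sum, Prod.smul_snd,
      ident_snd_of_mem_charSet (he _), ← pi_eq_sum_univ', sub_self]
  rw [← sub_add_cancel χ (∑ k, (P.ident i χ).2 k • e k)]
  exact H.add_mem (hbaseH hdiff) (H.sum_mem fun k _ => H.zsmul_mem (hmem (he k)) _)

end BlockScaling

variable (i : Fin 2)

section Trivialization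

/-- The coordinates of a point of `T` in the fibre of `X⁽ⁱ⁾ → Y⁽ⁱ⁾` through it. -/
def fibreCoordinates (t : Torus L) (k : Fin r) : ℂˣ := t ((P.ident i).symm (0, Pi.single k 1))

theorem apply_eq_proj_mul_prod_fibreCoordinates (t : Torus L) (χ : L) :
    t χ = P.proj i t (P.ident i χ).1 * ∏ k, P.fibreCoordinates i t k ^ (P.ident i χ).2 k := by
  have hfibre := torus_apply_eq_prod_zpow (t.compAddMonoidHom
    ((P.ident i).symm.toAddMonoidHom.comp (AddMonoidHom.inr (Fin n → ℤ) (Fin r → ℤ))))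
    (P.ident i χ).2
  calc t χ = t ((P.ident i).symm ((P.ident i χ).1, 0) + (P.ident i).symm (0, (P.ident i χ).2)) := by
        rw [← map_add, Prod.fst_add_snd, AddEquiv.symm_apply_apply]
    _ = _ := by
        rw [AddChar.map_add_eq_mul]
        exact congrArg _ hfibre

/-- The trivialization `T ≅ T_{Y⁽ⁱ⁾} × 𝔾_m^r` of the torus of `X⁽ⁱ⁾` over the torus of `Y⁽ⁱ⁾`. -/
def trivialization : Torus L ≃* Torus (Fin n → ℤ) × (Fin r → ℂˣ) where
  toFun t := (P.proj i t, P.fibreCoordinates i t)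
  invFun x :=
    { toFun := fun χ => x.1 (P.ident i χ).1 * ∏ k, x.2 k ^ (P.ident i χ).2 k
      map_zero_eq_one' := by simp
      map_add_eq_mul' := fun χ₁ χ₂ => by
        simp [AddChar.map_add_eq_mul, _root_.zpow_add, Finset.prod_mul_distrib,
          mul_mul_mul_comm] }
  left_inv t := DFunLike.ext _ _ fun χ => (P.apply_eq_proj_mul_prod_fibreCoordinates i t χ).symm
  right_inv x := by
    refine Prod.ext (DFunLike.ext _ _ fun m => ?_) (funext fun k => ?_)
    · simp [proj]
    · simp [fibreCoordinates, Pi.single_apply]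
  map_mul' _ _ := rfl

theorem proj_trivialization_symm (y : Torus (Fin n → ℤ)) (x : Fin r → ℂˣ) :
    P.proj i ((P.trivialization i).symm (y, x)) = y :=
  congrArg Prod.fst ((P.trivialization i).apply_symm_apply (y, x))

theorem fibreCoordinates_trivialization_symm (y : Torus (Fin n → ℤ)) (x : Fin r → ℂˣ) :
    P.fibreCoordinates i ((P.trivialization i).symm (y, x)) = x :=
  congrArg Prod.snd ((P.trivialization i).apply_symm_apply (y, x))

theorem trivialization_blockScaling (lam : P.BlockTorus) :
    P.trivialization i (P.blockScaling i lam) = (1, lam ∘ P.component) := by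
  rw [← MulEquiv.eq_symm_apply]
  exact DFunLike.ext _ _ fun χ => (one_mul _).symm

theorem proj_blockScaling_mul (lam : P.BlockTorus) (t : Torus L) :
    P.proj i (P.blockScaling i lam * t) = P.proj i t := by
  have h := map_mul (P.trivialization i) (P.blockScaling i lam) t
  rw [trivialization_blockScaling] at h
  exact (congrArg Prod.fst h).trans (one_mul (P.proj i t))

theorem fibreCoordinates_blockScaling_mul (lam : P.BlockTorus) (t : Torus L) :
    P.fibreCoordinates i (P.blockScaling i lam * t) =
      (lam ∘ P.component) * P.fibreCoordinates i t := by
  have h := map_mul (P.trivialization i) (P.blockScaling i lam) t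
  rw [trivialization_blockScaling] at h
  exact congrArg Prod.snd h

end Trivialization

section Matrices

open Classical in
/-- The matrix `(W)` as seen from `X⁽ⁱ⁾`: its rows are indexed by the sets `Λ_a⁽ⁱ⁾`, so that it is
`(W)` for `i = 0` and the transpose of `(W)` for `i = 1`. -/
noncomputable def sideMatrix (t : Torus L) : Matrix (Fin r) (Fin r) ℂ :=
  of fun a b => ∑ χ ∈ P.charSet i a ∩ P.charSet i.rev b, P.W χ * (t χ : ℂ)

open Classical in
/-- The matrix on `T_{Y⁽ⁱ⁾}` that is left of `sideMatrix` after the `a`-th row has been divided by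
the `a`-th fibre coordinate. -/
noncomputable def baseMatrix (y : Torus (Fin n → ℤ)) : Matrix (Fin r) (Fin r) ℂ :=
  of fun a b => ∑ χ ∈ P.charSet i a ∩ P.charSet i.rev b, P.W χ * (y (P.ident i χ).1 : ℂ)

theorem sideMatrix_rev (t : Torus L) : P.sideMatrix i.rev t = (P.sideMatrix i t)ᵀ := by
  ext a b
  simp only [sideMatrix, of_apply, transpose_apply, Fin.rev_rev, Finset.inter_comm]

theorem rank_sideMatrix (t : Torus L) : (P.sideMatrix i t).rank = (P.matrixW t).rank := by
  fin_cases i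
  · rfl
  · exact (congrArg rank (P.sideMatrix_rev 0 t)).trans (rank_transpose _)

theorem sideMatrix_eq_diagonal_mul_baseMatrix (t : Torus L) :
    P.sideMatrix i t =
      diagonal (Units.val ∘ P.fibreCoordinates i t) * P.baseMatrix i (P.proj i t) := by
  classical
  ext a b
  simp only [sideMatrix, baseMatrix, diagonal_mul, of_apply, Finset.mul_sum]
  refine Finset.sum_congr rfl fun χ hχ => ?_
  have hprod : ∏ k, P.fibreCoordinates i t k ^ (P.ident i χ).2 k = P.fibreCoordinates i t a := by
    rw [ident_snd_of_mem_charSet (Finset.mem_inter.1 hχ).1,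
      Finset.prod_eq_single a (fun k _ hk => by rw [Pi.single_eq_of_ne hk, zpow_zero]) (by simp),
      Pi.single_eq_same, zpow_one]
  rw [P.apply_eq_proj_mul_prod_fibreCoordinates i t χ, hprod, Units.val_mul, Function.comp_apply]
  ring

theorem isBlockDiagonal_baseMatrix (y : Torus (Fin n → ℤ)) :
    IsBlockDiagonal P.component (P.baseMatrix i y) := by
  classical
  exact fun a b hab => Finset.sum_eq_zero fun χ hχ =>
    (hab ((Finset.mem_inter.1 hχ).elim component_eq_of_mem_charSet)).elim

theorem baseMatrix_mulVec_one (y : Torus (Fin n → ℤ)) :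
    P.baseMatrix i y *ᵥ 1 = fun k => laurentEval ((P.side i).sec k) y := by
  funext k
  calc (P.baseMatrix i y *ᵥ 1) k
      = ∑ χ ∈ P.charSet i k, P.W χ * (y (P.ident i χ).1 : ℂ) := by
        rw [← P.sum_sum_charSet_inter]
        simp only [mulVec, dotProduct, Pi.one_apply, mul_one, baseMatrix, of_apply]
    _ = (P.Wterm i k).sum fun χ c => c * (y (P.ident i χ).1 : ℂ) :=
        Finset.sum_congr rfl fun χ hχ => by rw [W_apply_of_mem_charSet hχ]
    _ = laurentEval ((P.side i).sec k) y := by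
        rw [Wterm, BundleWithSection.superpotentialTerm, Finsupp.sum_mapDomain_index,
          Finsupp.sum_mapDomain_index]
        · simp only [AddEquiv.apply_symm_apply]
          rfl
        all_goals simp [add_mul]

theorem mem_Z_iff (y : Torus (Fin n → ℤ)) : y ∈ P.Z i ↔ P.baseMatrix i y *ᵥ 1 = 0 := by
  rw [baseMatrix_mulVec_one, funext_iff]
  rfl

theorem mem_S_iff (t : Torus L) : t ∈ P.S i ↔ P.sideMatrix i t *ᵥ 1 = 0 := by
  change P.proj i t ∈ P.Z i ↔ _
  rw [mem_Z_iff, sideMatrix_eq_diagonal_mul_baseMatrix, ← mulVec_mulVec, funext_iff, funext_iff]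
  simp [mulVec_diagonal]

theorem mem_S_rev_iff (t : Torus L) :
    t ∈ P.S i.rev ↔ (Units.val ∘ P.fibreCoordinates i t) ᵥ* P.baseMatrix i (P.proj i t) = 0 := by
  have hone : (1 : Fin r → ℂ) ᵥ* diagonal (Units.val ∘ P.fibreCoordinates i t) =
      Units.val ∘ P.fibreCoordinates i t := by
    ext k
    rw [vecMul_diagonal, Pi.one_apply, one_mul]
  rw [mem_S_iff, sideMatrix_rev, mulVec_transpose, sideMatrix_eq_diagonal_mul_baseMatrix,
    ← vecMul_vecMul, hone]

theorem rank_baseMatrix_proj (t : Torus L) :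
    (P.baseMatrix i (P.proj i t)).rank = (P.matrixW t).rank := by
  rw [← P.rank_sideMatrix i, sideMatrix_eq_diagonal_mul_baseMatrix,
    rank_mul_eq_right_of_isUnit_det _ _ (by simp [det_diagonal, Finset.prod_ne_zero_iff])]

theorem mem_RR_iff_vecMul_baseMatrix (t : Torus L) :
    t ∈ P.RR ↔ P.proj i t ∈ P.Z i ∧
      (Units.val ∘ P.fibreCoordinates i t) ᵥ* P.baseMatrix i (P.proj i t) = 0 ∧
      (P.baseMatrix i (P.proj i t)).rank + P.blockCount = r := by
  rw [← mem_S_rev_iff, rank_baseMatrix_proj]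
  change (t ∈ P.S 0 ∧ _) ∧ (t ∈ P.S 1 ∧ _) ↔ t ∈ P.S i ∧ _
  fin_cases i
  · change _ ↔ t ∈ P.S 0 ∧ t ∈ P.S 1 ∧ _
    tauto
  · change _ ↔ t ∈ P.S 1 ∧ t ∈ P.S 0 ∧ _
    tauto

end Matrices

section Torsor

/-- A chosen index in each component, at which kernel vectors are normalized. -/
noncomputable def representative : P.Component → Fin r := Quotient.out

theorem leftInverse_component_representative :
    Function.LeftInverse P.component P.representative := Quotient.out_eq

/-- The determinant of `baseMatrix`, pinned at the representatives. It does not vanish on `Ω⁽ⁱ⁾`. -/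
noncomputable def pinnedDet (y : Torus (Fin n → ℤ)) : ℂ :=
  (pinnedMatrix (P.baseMatrix i y) P.representative).det

/-- The fibre coordinates of the point of `R⁽¹⁾ ∩ R⁽²⁾` over `y ∈ Ω⁽ⁱ⁾` whose fibre coordinates at
the representatives are `1`. -/
noncomputable def kernelVector (y : Torus (Fin n → ℤ)) : Fin r → ℂ :=
  normalizedKernelVector (P.baseMatrix i y) P.representative

variable {i} {y : Torus (Fin n → ℤ)}

theorem kernelVector_representative (hy : y ∈ P.Z i) (hdet : P.pinnedDet i y ≠ 0)
    (j : P.Component) : P.kernelVector i y (P.representative j) = 1 :=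
  congrFun ((P.isBlockDiagonal_baseMatrix i y).normalizedKernelVector_spec ((P.mem_Z_iff i y).1 hy)
    P.leftInverse_component_representative hdet.isUnit).2 j

theorem mem_RR_iff (i : Fin 2) (t : Torus L) :
    t ∈ P.RR ↔ (P.proj i t ∈ P.Z i ∧ P.pinnedDet i (P.proj i t) ≠ 0) ∧
      ∀ k, (P.fibreCoordinates i t k : ℂ) =
        P.fibreCoordinates i t (P.representative (P.component k)) *
          P.kernelVector i (P.proj i t) k := by
  rw [mem_RR_iff_vecMul_baseMatrix, and_assoc]
  refine and_congr_right fun hy => ?_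
  have hkernel := (P.isBlockDiagonal_baseMatrix i _).vecMul_eq_zero_and_rank_add_card_eq_iff
    ((P.mem_Z_iff i _).1 hy) P.leftInverse_component_representative
    (x := Units.val ∘ P.fibreCoordinates i t) fun j => Units.ne_zero _
  rw [Fintype.card_fin] at hkernel
  exact hkernel.trans (and_congr_right fun _ => funext_iff)

theorem mem_Omega_iff :
    y ∈ P.Omega i ↔ (y ∈ P.Z i ∧ P.pinnedDet i y ≠ 0) ∧ ∀ k, P.kernelVector i y k ≠ 0 := by
  refine ⟨?_, fun ⟨hy, hv⟩ => ?_⟩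
  · rintro ⟨t, ht, rfl⟩
    obtain ⟨hy, hfibre⟩ := (P.mem_RR_iff i t).1 ht
    exact ⟨hy, fun k => right_ne_zero_of_mul (hfibre k ▸ Units.ne_zero _)⟩
  · refine ⟨(P.trivialization i).symm (y, fun k => Units.mk0 _ (hv k)), (P.mem_RR_iff i _).2 ?_,
      P.proj_trivialization_symm i y _⟩
    simp only [proj_trivialization_symm, fibreCoordinates_trivialization_symm, Units.val_mk0,
      P.kernelVector_representative hy.1 hy.2, one_mul, implies_true, and_true]
    exact hy

theorem mem_RR_iff_proj_mem_Omega (i : Fin 2) (t : Torus L) :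
    t ∈ P.RR ↔ P.proj i t ∈ P.Omega i ∧
      ∀ k, (P.fibreCoordinates i t k : ℂ) =
        P.fibreCoordinates i t (P.representative (P.component k)) *
          P.kernelVector i (P.proj i t) k := by
  refine ⟨fun ht => ⟨⟨t, ht, rfl⟩, ((P.mem_RR_iff i t).1 ht).2⟩, fun ⟨hy, hfibre⟩ => ?_⟩
  exact (P.mem_RR_iff i t).2 ⟨((P.mem_Omega_iff).1 hy).1, hfibre⟩

theorem blockScaling_mul_mem_RR (i : Fin 2) (lam : P.BlockTorus) {t : Torus L} (ht : t ∈ P.RR) :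
    P.blockScaling i lam * t ∈ P.RR := by
  rw [P.mem_RR_iff i] at ht ⊢
  rw [proj_blockScaling_mul, fibreCoordinates_blockScaling_mul]
  refine ⟨ht.1, fun k => ?_⟩
  rw [Pi.mul_apply, Units.val_mul, ht.2 k, Pi.mul_apply, Units.val_mul, Function.comp_apply,
    Function.comp_apply, P.leftInverse_component_representative, mul_assoc]

theorem baseMatrix_mem_coordRing (i : Fin 2) (a b : Fin r) :
    (fun y => P.baseMatrix i y a b) ∈ coordRing (P := Torus (Fin n → ℤ)) := by
  classical
  exact fun_sum_mem fun χ _ =>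
    mul_mem (Subalgebra.algebraMap_mem _ (P.W χ)) (character_mem_coordRing _)

theorem pinnedDet_mem_coordRing (i : Fin 2) :
    P.pinnedDet i ∈ coordRing (P := Torus (Fin n → ℤ)) :=
  fun_det_mem fun a b =>
    add_mem (P.baseMatrix_mem_coordRing i a b) (Subalgebra.algebraMap_mem _ _)

theorem kernelVector_comp_mem_regularFunctions {Q : Type*} [HasCoordinateRing Q] {X : Set Q}
    {φ : X → Torus (Fin n → ℤ)} (hφ : ∀ g ∈ coordRing (P := Torus (Fin n → ℤ)),
      g ∘ φ ∈ regularFunctions X)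
    (hdet : ∀ x, P.pinnedDet i (φ x) ≠ 0) (k : Fin r) :
    (fun x => P.kernelVector i (φ x) k) ∈ regularFunctions X :=
  normalizedKernelVector_mem_regularFunctions (fun a b => hφ _ (P.baseMatrix_mem_coordRing i a b))
    hdet k

theorem isZariskiOpenIn_Omega (i : Fin 2) : IsZariskiOpenIn (P.Omega i) (P.Z i) := by
  have hOmega : P.Omega i =
      {y ∈ {y ∈ P.Z i | P.pinnedDet i y ≠ 0} | ∏ k, P.kernelVector i y k ≠ 0} := by
    ext y
    simp only [mem_Omega_iff, Set.mem_ofPred_eq, Finset.prod_ne_zero_iff, Finset.mem_univ,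
      true_implies]
  rw [hOmega]
  refine ((isZariskiOpenIn_refl _).sep_ne_zero
    (restrict_mem_regularFunctions (P.pinnedDet_mem_coordRing i))).sep_ne_zero ?_
  exact fun_prod_mem fun k _ => P.kernelVector_comp_mem_regularFunctions
    (fun g hg => restrict_mem_regularFunctions hg) (fun y => y.2.2) k

/-- `kernelVector` at a point of `Ω⁽ⁱ⁾`, where its entries are invertible. -/
noncomputable def kernelUnits (y : P.Omega i) (k : Fin r) : ℂˣ :=
  Units.mk0 (P.kernelVector i y k) ((P.mem_Omega_iff.1 y.2).2 k)

theorem kernelUnits_representative (y : P.Omega i) (j : P.Component) :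
    P.kernelUnits y (P.representative j) = 1 :=
  have hy := (P.mem_Omega_iff.1 y.2).1
  Units.ext (P.kernelVector_representative hy.1 hy.2 j)

theorem trivialization_symm_mem_RR (y : P.Omega i) (lam : P.BlockTorus) :
    (P.trivialization i).symm (y, (lam ∘ P.component) * P.kernelUnits y) ∈ P.RR := by
  rw [P.mem_RR_iff_proj_mem_Omega i, proj_trivialization_symm,
    fibreCoordinates_trivialization_symm]
  refine ⟨y.2, fun k => ?_⟩
  rw [Pi.mul_apply, Pi.mul_apply, kernelUnits_representative, mul_one, Function.comp_apply,
    Function.comp_apply, P.leftInverse_component_representative]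
  rfl

/-- The trivialization of the torsor `R⁽¹⁾ ∩ R⁽²⁾ → Ω⁽ⁱ⁾` by the fibre coordinates at the
representatives of the components. -/
noncomputable def torsorEquiv (i : Fin 2) :
    P.RR ≃ (P.Omega i ×ˢ (Set.univ : Set P.BlockTorus) :
      Set (Torus (Fin n → ℤ) × P.BlockTorus)) where
  toFun t := ⟨(P.proj i t, P.fibreCoordinates i t ∘ P.representative), ⟨t, t.2, rfl⟩, trivial⟩
  invFun z := ⟨_, P.trivialization_symm_mem_RR ⟨z.1.1, z.2.1⟩ z.1.2⟩
  left_inv t := by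
    refine Subtype.ext ((P.trivialization i).symm_apply_eq.2 (Prod.ext rfl (funext fun k => ?_)))
    exact Units.ext (((P.mem_RR_iff i t).1 t.2).2 k).symm
  right_inv z := by
    refine Subtype.ext (Prod.ext (P.proj_trivialization_symm i _ _) (funext fun j => ?_))
    simp only [fibreCoordinates_trivialization_symm, Function.comp_apply, Pi.mul_apply,
      kernelUnits_representative, mul_one, P.leftInverse_component_representative j]

theorem torsorEquiv_blockScaling_mul (i : Fin 2) (lam : P.BlockTorus) (t : P.RR)
    (h : P.blockScaling i lam * t ∈ P.RR) :
    (P.torsorEquiv i ⟨P.blockScaling i lam * t, h⟩).1 =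
      ((P.torsorEquiv i t).1.1, lam * (P.torsorEquiv i t).1.2) := by
  refine Prod.ext (P.proj_blockScaling_mul i lam t) (funext fun j => ?_)
  change P.fibreCoordinates i (P.blockScaling i lam * t) (P.representative j) = _
  rw [fibreCoordinates_blockScaling_mul, Pi.mul_apply, Function.comp_apply,
    P.leftInverse_component_representative]
  rfl

theorem isRegularMap_torsorEquiv (i : Fin 2) : IsRegularMap (P.torsorEquiv i) := by
  have hchar (χ : L) : (fun t : P.RR => (t.1 χ : ℂ)) ∈ regularFunctions P.RR :=
    restrict_mem_regularFunctions (character_mem_coordRing χ)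
  refine isRegularMap_iff.2 fun g hg => comp_mem_of_fst_mem_of_snd_mem
    (φ := Subtype.val ∘ P.torsorEquiv i) (fun g hg => ?_) (fun g hg => ?_) hg
  · exact comp_mem_of_character_mem (φ := fun t : P.RR => P.proj i t) (fun m => hchar _) hg
  · exact comp_mem_regularFunctions_of_coordinate_mem
      (φ := fun t : P.RR => P.fibreCoordinates i t ∘ P.representative) (fun j => hchar _) hg

theorem isRegularMap_torsorEquiv_symm (i : Fin 2) : IsRegularMap (P.torsorEquiv i).symm := by
  refine isRegularMap_iff.2 fun g hg => comp_mem_of_character_mem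
    (φ := Subtype.val ∘ (P.torsorEquiv i).symm) (fun χ => ?_) hg
  have hfst (g) (hg : g ∈ coordRing (P := Torus (Fin n → ℤ))) :
      (fun z : (P.Omega i ×ˢ Set.univ : Set (Torus (Fin n → ℤ) × P.BlockTorus)) => g z.1.1) ∈
        regularFunctions (P.Omega i ×ˢ Set.univ) :=
    restrict_mem_regularFunctions (comp_fst_mem_coordRing hg)
  have hfibre (k : Fin r) : (fun z : (P.Omega i ×ˢ Set.univ :
      Set (Torus (Fin n → ℤ) × P.BlockTorus)) =>
        (z.1.2 (P.component k) : ℂ) * P.kernelVector i z.1.1 k) ∈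
        regularFunctions (P.Omega i ×ˢ Set.univ) :=
    mul_mem (restrict_mem_regularFunctions (comp_snd_mem_coordRing (coordinate_mem_coordRing _)))
      (P.kernelVector_comp_mem_regularFunctions hfst (fun z => (P.mem_Omega_iff.1 z.2.1).1.2) k)
  have hχ : (fun z => (((P.torsorEquiv i).symm z).1 χ : ℂ)) = fun z =>
      (z.1.1 (P.ident i χ).1 : ℂ) *
        ∏ k, ((z.1.2 (P.component k) : ℂ) * P.kernelVector i z.1.1 k) ^ (P.ident i χ).2 k := by
    funext z
    change ((z.1.1 (P.ident i χ).1 * ∏ k, (z.1.2 (P.component k) *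
      P.kernelUnits ⟨z.1.1, z.2.1⟩ k) ^ (P.ident i χ).2 k : ℂˣ) : ℂ) = _
    simp [kernelUnits]
  refine hχ ▸ mul_mem (hfst _ (character_mem_coordRing _)) (fun_prod_mem fun k _ =>
    zpow_mem_regularFunctions (hfibre k) (fun z => ?_) _)
  exact mul_ne_zero (Units.ne_zero _) ((P.mem_Omega_iff.1 z.2.1).2 k)

theorem isRegularMap_blockScaling (i : Fin 2)
    (h : ∀ lam : P.BlockTorus, ∀ t ∈ P.RR, P.blockScaling i lam * t ∈ P.RR) :
    IsRegularMap (X := (Set.univ : Set P.BlockTorus) ×ˢ P.RR) (Y := P.RR)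
      (fun x => ⟨P.blockScaling i x.1.1 * x.1.2, h x.1.1 x.1.2 x.2.2⟩) := by
  refine isRegularMap_iff.2 fun g hg => comp_mem_of_character_mem
    (φ := fun x : (Set.univ ×ˢ P.RR : Set (P.BlockTorus × Torus L)) =>
      P.blockScaling i x.1.1 * x.1.2) (fun χ => ?_) hg
  have hχ : (fun x : (Set.univ ×ˢ P.RR : Set (P.BlockTorus × Torus L)) =>
      ((P.blockScaling i x.1.1 * x.1.2) χ : ℂ)) = fun x =>
        (∏ k, (x.1.1 (P.component k) : ℂ) ^ (P.ident i χ).2 k) * (x.1.2 χ : ℂ) := by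
    funext x
    simp [blockScaling]
  refine hχ ▸ mul_mem (fun_prod_mem fun k _ => zpow_mem_regularFunctions ?_
    (fun x => Units.ne_zero _) _) ?_
  · exact restrict_mem_regularFunctions (comp_fst_mem_coordRing (coordinate_mem_coordRing _))
  · exact restrict_mem_regularFunctions (comp_snd_mem_coordRing (character_mem_coordRing χ))

end Torsor

end MirrorPair

theorem mainTheorem6_general {n r : ℕ} {L : Type*} [AddCommGroup L] (P : MirrorPair n r L)
    (hW : AddSubgroup.closure (P.W.support : Set L) = ⊤) :
    P.blockScaling 0 = P.blockScaling 1 ∧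
    ∃ hR : ∀ lam : P.BlockTorus, ∀ t ∈ P.RR, P.blockScaling 0 lam * t ∈ P.RR,
      IsRegularMap (X := (Set.univ : Set P.BlockTorus) ×ˢ P.RR) (Y := P.RR)
        (fun x => ⟨P.blockScaling 0 x.1.1 * x.1.2, hR x.1.1 x.1.2 x.2.2⟩) ∧
      ∀ i : Fin 2,
        IsZariskiOpenIn (P.Omega i) (P.Z i) ∧
        ∃ Φ : P.RR ≃ ((P.Omega i ×ˢ (Set.univ : Set P.BlockTorus) :
            Set (Torus (Fin n → ℤ) × P.BlockTorus))),
          IsRegularMap Φ ∧ IsRegularMap Φ.symm ∧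
          (∀ t : P.RR, (Φ t).1.1 = P.proj i t.1) ∧
          ∀ (lam : P.BlockTorus) (t : P.RR),
            (Φ ⟨P.blockScaling 0 lam * t.1, hR lam t.1 t.2⟩).1 =
              ((Φ t).1.1, lam * (Φ t).1.2) := by
  have hside (i : Fin 2) : P.blockScaling 0 = P.blockScaling i := by
    fin_cases i
    · rfl
    · exact P.blockScaling_eq hW
  refine ⟨P.blockScaling_eq hW, fun lam t ht => P.blockScaling_mul_mem_RR 0 lam ht,
    P.isRegularMap_blockScaling 0 _, fun i => ⟨P.isZariskiOpenIn_Omega i, P.torsorEquiv i,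
      P.isRegularMap_torsorEquiv i, P.isRegularMap_torsorEquiv_symm i, fun _ => rfl,
      fun lam t => ?_⟩⟩
  simp only [hside i]
  exact P.torsorEquiv_blockScaling_mul i lam t _

theorem mainTheorem6 {n r : ℕ} {L : Type*} [AddCommGroup L] (P : MirrorPair n r L)
    (h₁ : P.DiagonalNonempty) (h₂ : P.RatiosGenerate) :
    -- rescaling blockwise means the same from the point of view of both fibrations
    P.blockScaling 0 = P.blockScaling 1 ∧
    -- it preserves `R⁽¹⁾ ∩ R⁽²⁾`, and is an algebraic action there
    ∃ hR : ∀ lam : P.BlockTorus, ∀ t ∈ P.RR, P.blockScaling 0 lam * t ∈ P.RR,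
      IsRegularMap (X := (Set.univ : Set P.BlockTorus) ×ˢ P.RR) (Y := P.RR)
        (fun x => ⟨P.blockScaling 0 x.1.1 * x.1.2, hR x.1.1 x.1.2 x.2.2⟩) ∧
      ∀ i : Fin 2,
        IsZariskiOpenIn (P.Omega i) (P.Z i) ∧
        -- an equivariant isomorphism of varieties over `Ω⁽ⁱ⁾`
        ∃ Φ : P.RR ≃ ((P.Omega i ×ˢ (Set.univ : Set P.BlockTorus) :
            Set (Torus (Fin n → ℤ) × P.BlockTorus))),
          IsRegularMap Φ ∧ IsRegularMap Φ.symm ∧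
          (∀ t : P.RR, (Φ t).1.1 = P.proj i t.1) ∧
          ∀ (lam : P.BlockTorus) (t : P.RR),
            (Φ ⟨P.blockScaling 0 lam * t.1, hR lam t.1 t.2⟩).1 =
              ((Φ t).1.1, lam * (Φ t).1.2) :=
  mainTheorem6_general P (P.closure_support_W_eq_top (i := 0)
    (fun k => (h₁ k).imp fun _ => And.left) (h₂ 0).ge)
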